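/- Let $1\le k\le d$ be integers. Let $\mathcal G_{k,d}=\{P\in\mathbb R^{d\times d}: P^\top=P,\ P^2=P,\ \operatorname{trace}P=k\}$, and let $\sigma_{k,d}$ be the orthogonally invariant probability measure on $\mathcal G_{k,d}$ induced by the Haar probability measure on the orthogonal group $\mathcal O(d)$ through the conjugation action $P\mapsto UPU^{\top}$. For integers $\ell,t\ge 0$ put $$\mathrm{Pol}^\ell_t(\mathcal G_{k,d})=\operatorname{span}\{\,P\mapsto \operatorname{trace}(MP)^s \;:\; M\in\mathbb R^{d\times d},\ M^\top=M,\ \operatorname{rank}M\le \ell,\ s\in\{0,\dots,t\}\,\},$$ a space of real functions on $\mathcal G_{k,d}$. For $P_1,\dots,P_n\in\mathcal G_{k,d}$ and $\omega_1,\dots,\omega_n\in\mathbb R$, the family $\{(P_j,\omega_j)\}_{j=1}^n$ is called a cubature for $\mathrm{Pol}^\ell_t(\mathcal G_{k,d})$ if $\sum_{j=1}^n\omega_j f(P_j)=\int_{\mathcal G_{k,d}} f\,d\sigma_{k,d}$ for all $f\in\mathrm{Pol}^\ell_t(\mathcal G_{k,d})$. **Corollary 2.3.** Let $t\ge 0$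 and let $\alpha\in\mathbb N^d$ with $|\alpha|=t$. There are coefficients $a^\alpha_\beta\in\mathbb R$ ($\beta\in\mathbb N^d$, $|\beta|\le t$), depending only on $k$, $d$ and $\alpha$, such that for every cubature $\{(P_j,\omega_j)\}_{j=1}^n$ for $\mathrm{Pol}^2_t(\mathcal G_{k,d})$ and every random vector $X$ with values in the unit sphere $\mathbb S^{d-1}\subset\mathbb R^d$ (almost surely), $$\mathbb E X^\alpha=\sum_{|\beta|\le t}a^\alpha_\beta\sum_{j=1}^n\omega_j\,\mathbb E (P_jX)^\beta .$$ Here $x^\beta=\prod_{i=1}^d x_i^{\beta_i}$, with $0^0=1$. -/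

import Mathlib

open MeasureTheory

namespace MomentCubature

/-- The Grassmann space `𝒢_{k,d}`: symmetric real `d × d` matrices `P` with `P² = P` and
`trace P = k`, i.e. the orthogonal projections of rank `k` on `ℝ^d`. -/
def Grassmannian (k d : ℕ) : Set (Matrix (Fin d) (Fin d) ℝ) :=
  {P | P.IsSymm ∧ P * P = P ∧ P.trace = (k : ℝ)}

/-- The orthogonal group `𝒪(d)`, with the topology inherited from the space of matrices. -/
abbrev O (d : ℕ) : Type := Matrix.orthogonalGroup (Fin d) ℝ

instance (d : ℕ) : MeasurableSpace (O d) := borel _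

instance (d : ℕ) : BorelSpace (O d) := ⟨rfl⟩

instance (k d : ℕ) : MeasurableSpace (Grassmannian k d) := borel _

instance (k d : ℕ) : BorelSpace (Grassmannian k d) := ⟨rfl⟩

instance (d : ℕ) : CompactSpace (O d) := by
  have hb : IsCompact (Set.pi Set.univ fun _ : Fin d =>
      Set.pi Set.univ fun _ : Fin d => Set.Icc (-1 : ℝ) 1) :=
    isCompact_univ_pi fun _ => isCompact_univ_pi fun _ => isCompact_Icc
  have hc : IsClosed {A : Matrix (Fin d) (Fin d) ℝ | A * star A = 1} :=
    isClosed_eq (by fun_prop) continuous_const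
  refine isCompact_iff_compactSpace.mp (IsCompact.of_isClosed_subset hb ?_ ?_)
  · convert hc using 1
    ext A
    exact Matrix.mem_orthogonalGroup_iff (Fin d) ℝ
  · intro A hA i _ j _
    exact abs_le.mp (entry_norm_bound_of_unitary hA i j)

/-- The diagonal `d × d` matrix with `k` ones followed by zeros. -/
def diagProj (k d : ℕ) : Matrix (Fin d) (Fin d) ℝ :=
  Matrix.diagonal fun i => if (i : ℕ) < k then 1 else 0

theorem diagProj_mem {k d : ℕ} (hkd : k ≤ d) : diagProj k d ∈ Grassmannian k d := by
  refine ⟨Matrix.isSymm_diagonal _, ?_, ?_⟩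
  · simp [diagProj, Matrix.diagonal_mul_diagonal]
  · simp only [diagProj, Matrix.trace_diagonal, Finset.sum_boole, Nat.cast_inj]
    have h : (Finset.univ.filter fun i : Fin d => (i : ℕ) < k)
        = Finset.univ.map (Fin.castLEEmb hkd) := by
      ext i
      simp only [Finset.mem_filter, Finset.mem_univ, true_and, Finset.mem_map]
      exact ⟨fun hi => ⟨⟨i, hi⟩, rfl⟩, by rintro ⟨j, rfl⟩; exact j.2⟩
    rw [h]
    simp

theorem conj_mem {k d : ℕ} (U : O d) {P : Matrix (Fin d) (Fin d) ℝ}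
    (hP : P ∈ Grassmannian k d) : U.1 * P * U.1.transpose ∈ Grassmannian k d := by
  have hU : U.1.transpose * U.1 = 1 := (Matrix.mem_orthogonalGroup_iff' (Fin d) ℝ).mp U.2
  obtain ⟨h1, h2, h3⟩ := hP
  refine ⟨?_, ?_, ?_⟩
  · rw [Matrix.IsSymm, Matrix.transpose_mul, Matrix.transpose_mul, Matrix.transpose_transpose,
      h1.eq, Matrix.mul_assoc]
  · calc U.1 * P * U.1.transpose * (U.1 * P * U.1.transpose)
        = U.1 * P * (U.1.transpose * U.1) * P * U.1.transpose := by
          simp only [Matrix.mul_assoc]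
      _ = U.1 * P * U.1.transpose := by
          rw [hU, Matrix.mul_one, Matrix.mul_assoc U.1 P P, h2]
  · rw [Matrix.trace_mul_comm, ← Matrix.mul_assoc, hU, Matrix.one_mul, h3]

/-- The action of `𝒪(d)` on `𝒢_{k,d}` by conjugation, `P ↦ U P Uᵀ`. -/
def conj {k d : ℕ} (U : O d) (P : Grassmannian k d) : Grassmannian k d :=
  ⟨U.1 * P.1 * U.1.transpose, conj_mem U P.2⟩

/-- The Haar probability measure on the compact group `𝒪(d)`. -/
noncomputable def haarO (d : ℕ) : Measure (O d) := Measure.haarMeasure ⊤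

/-- The orthogonally invariant probability measure `σ_{k,d}` on `𝒢_{k,d}` (with its Borel
σ-algebra): the image of the Haar probability measure on `𝒪(d)` under the orbit map
`U ↦ U D Uᵀ`, where `D` is the diagonal matrix with `k` ones followed by zeros. -/
noncomputable def grassMeasure {k d : ℕ} (hkd : k ≤ d) : Measure (Grassmannian k d) :=
  (haarO d).map fun U => conj U ⟨diagProj k d, diagProj_mem hkd⟩

/-- `Pol^ℓ_t(𝒢_{k,d})`: the linear span of the functions `P ↦ ⟨M, P⟩ ^ s = trace (M P) ^ s`
on `𝒢_{k,d}`, for `M` symmetric with `rank M ≤ ℓ` and `0 ≤ s ≤ t`. -/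
noncomputable def Pol (k d ℓ t : ℕ) : Submodule ℝ (Grassmannian k d → ℝ) :=
  Submodule.span ℝ {f | ∃ M : Matrix (Fin d) (Fin d) ℝ, M.IsSymm ∧ M.rank ≤ ℓ ∧
    ∃ s : ℕ, s ≤ t ∧ f = fun P : Grassmannian k d => (M * P.1).trace ^ s}

/-- `{(P_j, w_j)}` is a cubature for `Pol^ℓ_t(𝒢_{k,d})`; the weights are arbitrary reals. -/
def IsCubature {k d : ℕ} (hkd : k ≤ d) (ℓ t : ℕ) {n : ℕ}
    (P : Fin n → Grassmannian k d) (w : Fin n → ℝ) : Prop :=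
  ∀ f ∈ Pol k d ℓ t, ∑ j, w j * f (P j) = ∫ Q, f Q ∂(grassMeasure hkd)

/-- The monomial `x ^ β = ∏ i, x_i ^ β_i`. -/
def monom {d : ℕ} (x : Fin d → ℝ) (β : Fin d → ℕ) : ℝ := ∏ i, x i ^ β i

/-- The finite set of multi-indices `β ∈ ℕ^d` with `|β| ≤ t`. -/
def multiIndices (d t : ℕ) : Finset (Fin d → ℕ) :=
  (Finset.range (t + 1)).biUnion fun s => Finset.piAntidiag Finset.univ s

theorem mem_multiIndices {d t : ℕ} (β : Fin d → ℕ) :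
    β ∈ multiIndices d t ↔ ∑ i, β i ≤ t := by
  simp [multiIndices]

end MomentCubature

namespace MomentCubature

open Matrix

variable {k d t : ℕ}

/-! Degree-`t` monomials are the coordinates of `x^{⊗t}`. Let `M` be the mean of `P^{⊗t}`. Each
`P^{⊗t}` is an orthogonal projection, so `c ↦ c·Mc` is nonnegative. It is definite on symmetric
tensors (`eq_zero_of_meanTensor`), because every `x` is fixed by some `P` when `k ≥ 1`. Hence each
coordinate of `x^{⊗t}` equals `a·M x^{⊗t}` for a symmetric `a` (`exists_symTensor_represents`). As
`a` is a combination of powers `y^{⊗t}`, and `y^{⊗t}·P^{⊗t}x^{⊗t} = ⟨y, Px⟩^t` is in `Pol k d 2 t`,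
a cubature reproduces this mean. The result is an identity pointwise in `x`, which is then
integrated. -/

/-- The coordinates of the tensor power `x^{⊗t}`, indexed by words of length `t`. -/
def tensorVec (t : ℕ) (x : Fin d → ℝ) : (Fin t → Fin d) → ℝ := fun v => ∏ m, x (v m)

/-- The matrix of the tensor power `P^{⊗t}`. -/
def tensorMat (t : ℕ) (P : Matrix (Fin d) (Fin d) ℝ) :
    Matrix (Fin t → Fin d) (Fin t → Fin d) ℝ :=
  Matrix.of fun v w => ∏ m, P (v m) (w m)

theorem prod_sum_eq_sum_words (f : Fin t → Fin d → ℝ) :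
    ∏ m, ∑ i, f m i = ∑ v : Fin t → Fin d, ∏ m, f m (v m) := by
  rw [Finset.prod_univ_sum, Fintype.piFinset_univ]

theorem dotProduct_self_nonneg {ι : Type*} [Fintype ι] (c : ι → ℝ) : 0 ≤ c ⬝ᵥ c :=
  Finset.sum_nonneg fun _ _ => mul_self_nonneg _

theorem rank_add_le (A B : Matrix (Fin d) (Fin d) ℝ) : (A + B).rank ≤ A.rank + B.rank := by
  unfold Matrix.rank
  rw [mulVecLin_add]
  exact (Submodule.finrank_mono (LinearMap.range_add_le _ _)).trans
    (Submodule.finrank_add_le_finrank_add_finrank _ _)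

theorem tensorVec_dotProduct (x y : Fin d → ℝ) :
    tensorVec t x ⬝ᵥ tensorVec t y = (x ⬝ᵥ y) ^ t := by
  simp only [dotProduct, tensorVec, ← Finset.prod_mul_distrib]
  rw [← prod_sum_eq_sum_words fun _ i => x i * y i]
  simp

theorem tensorMat_mulVec (P : Matrix (Fin d) (Fin d) ℝ) (x : Fin d → ℝ) :
    tensorMat t P *ᵥ tensorVec t x = tensorVec t (P *ᵥ x) := by
  ext v
  simp only [mulVec, dotProduct, tensorVec, tensorMat, of_apply, ← Finset.prod_mul_distrib,
    prod_sum_eq_sum_words]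

theorem tensorMat_mul (P Q : Matrix (Fin d) (Fin d) ℝ) :
    tensorMat t P * tensorMat t Q = tensorMat t (P * Q) := by
  ext v w
  simp only [mul_apply, tensorMat, of_apply, ← Finset.prod_mul_distrib,
    prod_sum_eq_sum_words]

theorem tensorMat_transpose (P : Matrix (Fin d) (Fin d) ℝ) :
    (tensorMat t P)ᵀ = tensorMat t Pᵀ := rfl

/-- `P^{⊗t}` inherits symmetry and idempotence from `P`. The form is thus nonnegative, and vanishes
only on the kernel of `P^{⊗t}`. -/
theorem dotProduct_tensorMat_self (P : Grassmannian k d) (c : (Fin t → Fin d) → ℝ) :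
    c ⬝ᵥ tensorMat t P.1 *ᵥ c = (tensorMat t P.1 *ᵥ c) ⬝ᵥ (tensorMat t P.1 *ᵥ c) := by
  have hT : c ᵥ* tensorMat t P.1 = tensorMat t P.1 *ᵥ c := by
    rw [← mulVec_transpose, tensorMat_transpose, P.2.1.eq]
  conv_lhs => rw [← P.2.2.1, ← tensorMat_mul, ← mulVec_mulVec, dotProduct_mulVec, hT]

/-- The symmetric tensors, as the span of the powers `x^{⊗t}`. -/
def symTensors (d t : ℕ) : Submodule ℝ ((Fin t → Fin d) → ℝ) :=
  Submodule.span ℝ (Set.range (tensorVec t))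

theorem eq_zero_of_mem_symTensors {c : (Fin t → Fin d) → ℝ} (hc : c ∈ symTensors d t)
    (h : ∀ x, c ⬝ᵥ tensorVec t x = 0) : c = 0 := by
  have : ∀ b ∈ symTensors d t, c ⬝ᵥ b = 0 := by
    intro b hb
    induction hb using Submodule.span_induction with
    | mem b hb => obtain ⟨x, rfl⟩ := hb; exact h x
    | zero => simp
    | add a b _ _ ha hb => rw [dotProduct_add, ha, hb, add_zero]
    | smul r a _ ha => rw [dotProduct_smul, ha, smul_zero]
  exact dotProduct_self_eq_zero.mp (this c hc)

/-! ### Orbit of the orthogonal group and invariant integration -/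

/-- The Householder reflection exchanging two vectors of equal length. -/
theorem exists_orthogonal_mulVec_eq {x y : Fin d → ℝ} (h : x ⬝ᵥ x = y ⬝ᵥ y) :
    ∃ U : O d, U.1 *ᵥ x = y ∧ U.1ᵀ *ᵥ y = x := by
  rcases eq_or_ne x y with rfl | hxy
  · exact ⟨1, by simp⟩
  obtain ⟨z, hz⟩ : ∃ z, z = x - y := ⟨_, rfl⟩
  have hz0 : z ⬝ᵥ z ≠ 0 := fun h0 =>
    hxy (sub_eq_zero.mp (hz ▸ dotProduct_self_eq_zero.mp h0))
  set H : Matrix (Fin d) (Fin d) ℝ := 1 - (2 / (z ⬝ᵥ z)) • vecMulVec z z with hH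
  have hsymm : Hᵀ = H := by
    simp [hH, transpose_sub, transpose_smul, transpose_vecMulVec]
  have happly : ∀ u, H *ᵥ u = u - (2 * (z ⬝ᵥ u) / (z ⬝ᵥ z)) • z := by
    intro u
    ext i
    simp [hH, sub_mulVec, smul_mulVec, vecMulVec_mulVec]
    ring
  have hsq : H * H = 1 := by
    refine ext_of_mulVec_single fun i => ?_
    set u : Fin d → ℝ := Pi.single i 1
    rw [← mulVec_mulVec, happly (H *ᵥ u), happly u, one_mulVec, dotProduct_sub, dotProduct_smul]
    ext j
    simp only [Pi.sub_apply, Pi.smul_apply, smul_eq_mul]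
    field_simp
    ring
  have hx : H *ᵥ x = y := by
    have h2 : 2 * (z ⬝ᵥ x) = z ⬝ᵥ z := by
      simp only [hz, sub_dotProduct, dotProduct_sub, dotProduct_comm y x]
      linarith
    rw [happly, h2, div_self hz0, one_smul, hz, sub_sub_cancel]
  refine ⟨⟨H, (mem_orthogonalGroup_iff (Fin d) ℝ).mpr ?_⟩, hx, ?_⟩
  · change H * Hᵀ = 1
    rw [hsymm, hsq]
  · change Hᵀ *ᵥ y = x
    rw [hsymm, ← hx, mulVec_mulVec, hsq, one_mulVec]

/-- The orbit map whose image measure is `σ_{k,d}`. -/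
def orbit (hkd : k ≤ d) (U : O d) : Grassmannian k d := conj U ⟨diagProj k d, diagProj_mem hkd⟩

theorem continuous_orbit (hkd : k ≤ d) : Continuous (orbit hkd) := by
  unfold orbit conj
  fun_prop

/-- Since `k ≥ 1`, `diagProj k d` fixes the first basis vector; conjugate by a reflection carrying
its multiple of length `|x|` to `x`. -/
theorem exists_orbit_mulVec_eq (hk : 1 ≤ k) (hkd : k ≤ d) (x : Fin d → ℝ) :
    ∃ U : O d, (orbit hkd U).1 *ᵥ x = x := by
  set i : Fin d := ⟨0, by omega⟩
  obtain ⟨U, h1, h2⟩ := exists_orthogonal_mulVec_eq (x := Pi.single i √(x ⬝ᵥ x)) (y := x)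
    (by simp [Real.mul_self_sqrt (dotProduct_self_nonneg x)])
  refine ⟨U, ?_⟩
  have hD : diagProj k d *ᵥ Pi.single i √(x ⬝ᵥ x) = Pi.single i √(x ⬝ᵥ x) := by
    ext j
    rw [diagProj, mulVec_diagonal]
    rcases eq_or_ne j i with rfl | hj
    · simp [i, show 0 < k by omega]
    · simp [hj]
  change (U.1 * diagProj k d * U.1ᵀ) *ᵥ x = x
  rw [← mulVec_mulVec, h2, ← mulVec_mulVec, hD, h1]

instance (d : ℕ) : IsProbabilityMeasure (haarO d) :=
  ⟨Measure.haarMeasure_self (K₀ := (⊤ : TopologicalSpace.PositiveCompacts (O d)))⟩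

instance (d : ℕ) : (haarO d).IsOpenPosMeasure := by
  unfold haarO
  infer_instance

theorem integrable_haarO {f : O d → ℝ} (hf : Continuous f) : Integrable f (haarO d) :=
  hf.integrable_of_hasCompactSupport (HasCompactSupport.of_compactSpace f)

theorem integral_grassMeasure (hkd : k ≤ d) {f : Grassmannian k d → ℝ} (hf : Continuous f) :
    ∫ Q, f Q ∂(grassMeasure hkd) = ∫ U, f (orbit hkd U) ∂(haarO d) :=
  integral_map (continuous_orbit hkd).measurable.aemeasurable hf.aestronglyMeasurable

theorem continuous_tensorMat_orbit (hkd : k ≤ d) :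
    Continuous fun U => tensorMat t (orbit hkd U).1 := by
  have h : Continuous fun U => (orbit hkd U).1 := continuous_subtype_val.comp (continuous_orbit hkd)
  refine continuous_matrix fun v w => ?_
  simp only [tensorMat, of_apply]
  exact continuous_finsetProd _ fun m _ => h.matrix_elem _ _

/-! ### The averaged tensor power and its definiteness -/

/-- The average of `P^{⊗t}` over the Grassmannian. -/
noncomputable def meanTensor (hkd : k ≤ d) (t : ℕ) :
    Matrix (Fin t → Fin d) (Fin t → Fin d) ℝ :=
  Matrix.of fun v w => ∫ U, tensorMat t (orbit hkd U).1 v w ∂(haarO d)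

theorem dotProduct_meanTensor (hkd : k ≤ d) (a c : (Fin t → Fin d) → ℝ) :
    a ⬝ᵥ meanTensor hkd t *ᵥ c = ∫ U, a ⬝ᵥ tensorMat t (orbit hkd U).1 *ᵥ c ∂(haarO d) := by
  have hint : ∀ v w, Integrable (fun U => tensorMat t (orbit hkd U).1 v w) (haarO d) :=
    fun v w => integrable_haarO ((continuous_tensorMat_orbit hkd).matrix_elem v w)
  simp only [dotProduct, mulVec, meanTensor, of_apply]
  rw [integral_finsetSum _ fun v _ =>
    (integrable_finsetSum _ fun w _ => (hint v w).mul_const _).const_mul _]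
  refine Finset.sum_congr rfl fun v _ => ?_
  rw [integral_const_mul, integral_finsetSum _ fun w _ => (hint v w).mul_const _]
  simp only [integral_mul_const]

theorem eq_zero_of_meanTensor (hk : 1 ≤ k) (hkd : k ≤ d) {c : (Fin t → Fin d) → ℝ}
    (hc : c ∈ symTensors d t) (h : c ⬝ᵥ meanTensor hkd t *ᵥ c = 0) : c = 0 := by
  have hcont : Continuous fun U => c ⬝ᵥ tensorMat t (orbit hkd U).1 *ᵥ c :=
    continuous_const.dotProduct ((continuous_tensorMat_orbit hkd).matrix_mulVec continuous_const)
  rw [dotProduct_meanTensor, integral_eq_zero_iff_of_nonneg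
    (fun U => by
      change 0 ≤ c ⬝ᵥ tensorMat t (orbit hkd U).1 *ᵥ c
      rw [dotProduct_tensorMat_self]; exact dotProduct_self_nonneg _)
    (integrable_haarO hcont)] at h
  -- Haar measure charges open sets, so a continuous function vanishing almost everywhere vanishes
  -- everywhere.
  have hzero := (hcont.ae_eq_iff_eq (haarO d) continuous_const).mp h
  refine eq_zero_of_mem_symTensors hc fun x => ?_
  obtain ⟨U, hU⟩ := exists_orbit_mulVec_eq hk hkd x
  have h0 : tensorMat t (orbit hkd U).1 *ᵥ c = 0 := by
    rw [← dotProduct_self_eq_zero, ← dotProduct_tensorMat_self]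
    exact congrFun hzero U
  rw [← hU, ← tensorMat_mulVec, dotProduct_mulVec, ← mulVec_transpose, tensorMat_transpose,
    (orbit hkd U).2.1.eq, h0, zero_dotProduct]

/-- Every linear functional on the symmetric tensors is represented through the average of
`P^{⊗t}` by a symmetric tensor. -/
theorem exists_symTensor_represents (hk : 1 ≤ k) (hkd : k ≤ d) (v : Fin t → Fin d) :
    ∃ a ∈ symTensors d t, ∀ x,
      a ⬝ᵥ meanTensor hkd t *ᵥ tensorVec t x = tensorVec t x v := by
  let T : symTensors d t →ₗ[ℝ] Module.Dual ℝ (symTensors d t) :=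
    LinearMap.mk₂ ℝ (fun a c => a.1 ⬝ᵥ meanTensor hkd t *ᵥ c.1)
      (fun _ _ _ => add_dotProduct _ _ _) (fun _ _ _ => smul_dotProduct _ _ _)
      (fun _ _ _ => by simp [mulVec_add, dotProduct_add])
      (fun _ _ _ => by simp [mulVec_smul, dotProduct_smul])
  have hinj : Function.Injective T := by
    refine (injective_iff_map_eq_zero T).mpr fun a ha => Subtype.ext ?_
    -- Evaluating the zero functional at `a` itself reduces injectivity to definiteness.
    exact eq_zero_of_meanTensor hk hkd a.2 (LinearMap.congr_fun ha a)
  have hsurj := (LinearMap.injective_iff_surjective_of_finrank_eq_finrank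
    (Subspace.dual_finrank_eq (K := ℝ) (V := symTensors d t)).symm).mp hinj
  obtain ⟨a, ha⟩ := hsurj ((LinearMap.proj v).comp (symTensors d t).subtype)
  exact ⟨a.1, a.2, fun x =>
    LinearMap.congr_fun ha ⟨tensorVec t x, Submodule.subset_span ⟨x, rfl⟩⟩⟩

/-! ### Applying the cubature -/

/-- The functions `P ↦ ⟨y, P x⟩ ^ t` lie in `Pol 2 t`. -/
theorem dotProduct_mulVec_pow_mem_Pol (x y : Fin d → ℝ) :
    (fun P : Grassmannian k d => (y ⬝ᵥ P.1 *ᵥ x) ^ t) ∈ Pol k d 2 t := by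
  refine Submodule.subset_span
    -- The symmetric part of `x yᵀ`: it has the same trace pairing with symmetric `P`, and its rank
    -- bound is the reason for `ℓ = 2`.
    ⟨(1 / 2 : ℝ) • vecMulVec x y + (1 / 2 : ℝ) • vecMulVec y x, ?_, ?_, t, le_rfl, ?_⟩
  · simp [IsSymm, transpose_add, transpose_smul, transpose_vecMulVec, add_comm]
  · rw [← vecMulVec_smul, ← vecMulVec_smul]
    exact (rank_add_le _ _).trans
      (add_le_add (rank_vecMulVec_le _ _) (rank_vecMulVec_le _ _))
  · funext P
    congr 1
    rw [add_mul, trace_add, smul_mul, smul_mul, trace_smul, trace_smul, vecMulVec_mul,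
      vecMulVec_mul, trace_vecMulVec, trace_vecMulVec, dotProduct_comm x, ← dotProduct_mulVec,
      dotProduct_comm y, ← mulVec_transpose, P.2.1.eq, dotProduct_comm _ y, smul_eq_mul]
    ring

theorem IsCubature.sum_tensorVec {hkd : k ≤ d} {n : ℕ} {P : Fin n → Grassmannian k d}
    {w : Fin n → ℝ} (h : IsCubature hkd 2 t P w) (x : Fin d → ℝ) {a : (Fin t → Fin d) → ℝ}
    (ha : a ∈ symTensors d t) :
    ∑ j, w j * (a ⬝ᵥ tensorVec t ((P j).1 *ᵥ x)) = a ⬝ᵥ meanTensor hkd t *ᵥ tensorVec t x := by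
  induction ha using Submodule.span_induction with
  | mem a ha =>
    obtain ⟨y, rfl⟩ := ha
    have hcont : Continuous fun Q : Grassmannian k d => (y ⬝ᵥ Q.1 *ᵥ x) ^ t :=
      (continuous_const.dotProduct
        (continuous_subtype_val.matrix_mulVec continuous_const)).pow t
    have := h _ (dotProduct_mulVec_pow_mem_Pol x y)
    rw [integral_grassMeasure hkd hcont] at this
    simpa only [tensorVec_dotProduct, dotProduct_meanTensor, tensorMat_mulVec] using this
  | zero => simp
  | add a b _ _ ha hb => simp only [add_dotProduct, mul_add, Finset.sum_add_distrib, ha, hb]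
  | smul r a _ ha =>
    simp only [smul_dotProduct, smul_eq_mul, ← ha, Finset.mul_sum]
    exact Finset.sum_congr rfl fun j _ => by ring

/-! ### From words to monomials -/

/-- The exponent of the monomial spelled by a word. -/
def wordCount (v : Fin t → Fin d) : Fin d → ℕ := fun i => (Finset.univ.filter (v · = i)).card

theorem tensorVec_apply (x : Fin d → ℝ) (v : Fin t → Fin d) :
    tensorVec t x v = monom x (wordCount v) := by
  simp only [tensorVec, monom, wordCount]
  rw [← Finset.prod_fiberwise (s := Finset.univ) (g := v)]
  exact Finset.prod_congr rfl fun i _ => Finset.prod_eq_pow_card fun m hm => by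
    rw [(Finset.mem_filter.mp hm).2]

theorem wordCount_mem (v : Fin t → Fin d) : wordCount v ∈ multiIndices d t := by
  rw [mem_multiIndices]
  have := Finset.card_eq_sum_card_fiberwise (s := Finset.univ) (t := Finset.univ) (f := v)
    fun _ _ => Finset.mem_coe.mpr (Finset.mem_univ _)
  rw [Finset.card_univ, Fintype.card_fin] at this
  exact this.ge

theorem exists_word {α : Fin d → ℕ} (hα : ∑ i, α i = t) :
    ∃ v : Fin t → Fin d, ∀ x, tensorVec t x v = monom x α := by
  subst hα
  -- The word lists each letter `i` exactly `α i` times, in consecutive blocks.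
  refine ⟨fun m => (finSigmaFinEquiv.symm m).1, fun x => ?_⟩
  rw [tensorVec, Equiv.prod_comp finSigmaFinEquiv.symm (fun s => x s.1), Fintype.prod_sigma, monom]
  simp

theorem continuous_monom (β : Fin d → ℕ) : Continuous fun x => monom x β := by
  unfold monom
  fun_prop

theorem exists_monom_eq_cubature (hk : 1 ≤ k) (hkd : k ≤ d) {α : Fin d → ℕ}
    (hα : ∑ i, α i = t) :
    ∃ a : (Fin d → ℕ) → ℝ, ∀ (n : ℕ) (P : Fin n → Grassmannian k d) (w : Fin n → ℝ),
      IsCubature hkd 2 t P w → ∀ x, monom x α =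
        ∑ β ∈ multiIndices d t, a β * ∑ j, w j * monom ((P j).1 *ᵥ x) β := by
  obtain ⟨v, hv⟩ := exists_word hα
  obtain ⟨a, ha, hrep⟩ := exists_symTensor_represents hk hkd v
  -- Collects the entries of `a` over all words spelling `β`; the sum is empty unless `|β| = t`.
  refine ⟨fun β => ∑ u with wordCount u = β, a u, fun n P w hP x => ?_⟩
  rw [← hv, ← hrep, ← hP.sum_tensorVec x ha]
  simp only [dotProduct, tensorVec_apply, Finset.mul_sum]
  rw [Finset.sum_comm, ← Finset.sum_fiberwise_of_maps_to fun u _ => wordCount_mem u]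
  refine Finset.sum_congr rfl fun β _ => ?_
  rw [Finset.sum_comm]
  refine Finset.sum_congr rfl fun j _ => ?_
  rw [Finset.sum_mul]
  refine Finset.sum_congr rfl fun u hu => ?_
  rw [(Finset.mem_filter.mp hu).2]
  ring

/-- Compactness of the sphere bounds `f (X ω)` almost surely, which justifies exchanging expectation
and finite sums. -/
theorem integrable_comp_of_mem_sphere {Ω : Type*} [MeasurableSpace Ω] {μ : Measure Ω}
    [IsProbabilityMeasure μ] {X : Ω → EuclideanSpace ℝ (Fin d)} (hX : AEMeasurable X μ)
    (hs : ∀ᵐ ω ∂μ, X ω ∈ Metric.sphere (0 : EuclideanSpace ℝ (Fin d)) 1)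
    {f : EuclideanSpace ℝ (Fin d) → ℝ} (hf : Continuous f) :
    Integrable (fun ω => f (X ω)) μ := by
  obtain ⟨C, hC⟩ := (isCompact_sphere (0 : EuclideanSpace ℝ (Fin d)) 1).exists_bound_of_continuousOn
    hf.continuousOn
  exact Integrable.of_bound (hf.measurable.comp_aemeasurable hX).aestronglyMeasurable C
    (hs.mono fun ω hω => hC _ hω)

end MomentCubature

theorem corollary2p3 {k d : ℕ} (hk : 1 ≤ k) (hkd : k ≤ d) (t : ℕ)
    (α : Fin d → ℕ) (hα : ∑ i, α i = t) :
    ∃ a : (Fin d → ℕ) → ℝ,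
      ∀ (n : ℕ) (P : Fin n → MomentCubature.Grassmannian k d) (w : Fin n → ℝ),
        MomentCubature.IsCubature hkd 2 t P w →
        ∀ (Ω : Type*) [MeasurableSpace Ω] (μ : MeasureTheory.Measure Ω)
          [MeasureTheory.IsProbabilityMeasure μ] (X : Ω → EuclideanSpace ℝ (Fin d)),
          AEMeasurable X μ →
          (∀ᵐ ω ∂μ, X ω ∈ Metric.sphere (0 : EuclideanSpace ℝ (Fin d)) 1) →
          ∫ ω, MomentCubature.monom (X ω).ofLp α ∂μ =
            ∑ β ∈ MomentCubature.multiIndices d t,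
              a β * ∑ j, w j *
                ∫ ω, MomentCubature.monom ((P j).1.mulVec (X ω).ofLp) β ∂μ := by
  obtain ⟨a, ha⟩ := MomentCubature.exists_monom_eq_cubature hk hkd hα
  refine ⟨a, fun n P w hP Ω _ μ _ X hX hs => ?_⟩
  have hint : ∀ β j, MeasureTheory.Integrable
      (fun ω => MomentCubature.monom ((P j).1.mulVec (X ω).ofLp) β) μ := fun β j =>
    MomentCubature.integrable_comp_of_mem_sphere hX hs
      (f := fun x => MomentCubature.monom ((P j).1.mulVec x.ofLp) β)
      ((MomentCubature.continuous_monom β).comp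
        (continuous_const.matrix_mulVec (PiLp.continuous_ofLp 2 _)))
  simp only [fun ω => ha n P w hP (X ω).ofLp]
  rw [MeasureTheory.integral_finsetSum _ fun β _ =>
    (MeasureTheory.integrable_finsetSum _ fun j _ => (hint β j).const_mul _).const_mul _]
  refine Finset.sum_congr rfl fun β _ => ?_
  rw [MeasureTheory.integral_const_mul,
    MeasureTheory.integral_finsetSum _ fun j _ => (hint β j).const_mul _]
  simp only [MeasureTheory.integral_const_mul]
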